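/- Let $T>0$, let $d,n\ge 0$ and $k\ge 1$ be integers, and let $\alpha:[0,T]\to(0,1)$ satisfy (A1) $\displaystyle\sup\{|h|^{\alpha(t)-\alpha(t+h)} : t,\,t+h\in[0,T],\ 0<|h|\le 1\}<\infty.$ Write $\mathcal C^{\alpha(\cdot)}([0,T];\mathbb R^n)$ for the set of functions $g:[0,T]\to\mathbb R^n$ with $$\sup\Big\{\frac{|g(t+h)-g(t)|}{|h|^{\alpha(t)}} : t,\,t+h\in[0,T],\ 0<|h|\le 1\Big\}<\infty.$$ Let $0<\tau_1<\dots<\tau_k$ be delays such that $$\inf\{\alpha(t)+\alpha(t-\tau_i) : 1\le i\le k,\ t\in[\tau_i,T]\}>1$$ (with $\inf\emptyset=+\infty$). Let $X\in\mathcal C^{\alpha(\cdot)}([0,T];\mathbb R^d)$, let $\xi\in C^1([-\tau_k,0];\mathbb R^n)$, and let $f:(\mathbb R^n)^k\to \mathcal L(\mathbb R^d,\mathbb R^n)$ be of class $C_b^2$, i.e. twice continuously differentiable and bounded together with its derivatives of order one and two. Then there is exactly one function $Y:[-\tau_k,T]\to\mathbb R^n$ with $Y|_{[0,T]}\in\mathcal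 C^{\alpha(\cdot)}([0,T];\mathbb R^n)$, with $Y_u=\xi_u$ for $u\in[-\tau_k,0]$, and with $$Y_t=\xi_0+\int_0^t f(Y_{r-\tau_1},\dots,Y_{r-\tau_k})\,dX_r\qquad\text{for all }t\in[0,T].$$ Here the integral is the Young integral, i.e. the limit (whose existence is part of being a solution) of the sums $\sum_{[u,v]\in\mathcal P}f(Y_{u-\tau_1},\dots,Y_{u-\tau_k})(X_v-X_u)$ over partitions $\mathcal P$ of $[0,t]$ as the mesh of $\mathcal P$ tends to $0$. No lower bound on $\alpha$ other than the condition above is required. -/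

import Mathlib

/-- Condition **A1** on the regularity function `α : [0,T] → (0,1)`:
`sup_{t ∈ [0,T], |h| ≤ 1} |h|^{α(t) - α(t+h)} < ∞`, where `t + h` ranges over `[0,T]`. -/
def ConditionA1 (T : ℝ) (α : ℝ → ℝ) : Prop :=
  ∃ C : ℝ, ∀ t ∈ Set.Icc 0 T, ∀ h : ℝ, |h| ≤ 1 → t + h ∈ Set.Icc 0 T →
    |h| ^ (α t - α (t + h)) ≤ C

/-- Membership of (the restriction to `[0,T]` of) `g` in the variable order Hölder space
`C^{α(·)}([0,T]; E)`: `sup_{t ∈ [0,T], |h| ≤ 1} ‖g (t+h) - g t‖ / |h|^{α(t)} < ∞`. -/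
def MemVarHolder {E : Type*} [NormedAddCommGroup E] (T : ℝ) (α : ℝ → ℝ) (g : ℝ → E) : Prop :=
  ∃ C : ℝ, ∀ t ∈ Set.Icc 0 T, ∀ h : ℝ, |h| ≤ 1 → t + h ∈ Set.Icc 0 T →
    ‖g (t + h) - g t‖ ≤ C * |h| ^ α t

/-- The class `C_b^2`: twice continuously differentiable, with the function and its derivatives up
to order two bounded. -/
def IsCb2 {E F : Type*} [NormedAddCommGroup E] [NormedSpace ℝ E] [NormedAddCommGroup F]
    [NormedSpace ℝ F] (f : E → F) : Prop :=
  ContDiff ℝ 2 f ∧ ∀ j : ℕ, j ≤ 2 → ∃ M : ℝ, ∀ x : E, ‖iteratedFDeriv ℝ j f x‖ ≤ M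

/-- `p 0 ≤ p 1 ≤ ⋯ ≤ p N` is a partition of `[a,b]` of mesh smaller than `δ`. -/
def IsFinePartition (a b δ : ℝ) (N : ℕ) (p : ℕ → ℝ) : Prop :=
  p 0 = a ∧ p N = b ∧ ∀ j < N, p j ≤ p (j + 1) ∧ p (j + 1) - p j < δ

/-- `I` is the Young integral `∫_a^b G dX`, the limit of the sums `∑ G_u (X_v - X_u)` over the
intervals `[u,v]` of partitions of `[a,b]` as the mesh tends to zero (for `a ≤ b`). -/
def IsYoungIntegral {V W : Type*} [NormedAddCommGroup V] [NormedSpace ℝ V] [NormedAddCommGroup W]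
    [NormedSpace ℝ W] (G : ℝ → V →L[ℝ] W) (X : ℝ → V) (a b : ℝ) (I : W) : Prop :=
  ∀ ε > 0, ∃ δ > 0, ∀ (N : ℕ) (p : ℕ → ℝ), IsFinePartition a b δ N p →
    ‖(∑ j ∈ Finset.range N, G (p j) (X (p (j + 1)) - X (p j))) - I‖ < ε

/-- `Y : [-τ_k,T] → ℝⁿ` solves the delayed Young differential equation
`dY_t = f(Y_{t-τ_1}, …, Y_{t-τ_k}) dX_t` on `[0,T]` with `Y = ξ` on `[-τ_k,0]`, and
`Y ∈ C^{α(·)}([0,T]; ℝⁿ)`. The delays `τ_1, …, τ_k` are indexed by `Fin (m + 1)`, `k = m + 1`, so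
that `τ_k` is `τ (Fin.last m)`. -/
structure IsDelaySolution {d n m : ℕ} (T : ℝ) (α : ℝ → ℝ) (τ : Fin (m + 1) → ℝ)
    (f : (Fin (m + 1) → EuclideanSpace ℝ (Fin n)) →
      EuclideanSpace ℝ (Fin d) →L[ℝ] EuclideanSpace ℝ (Fin n))
    (X : ℝ → EuclideanSpace ℝ (Fin d)) (ξ Y : ℝ → EuclideanSpace ℝ (Fin n)) : Prop where
  initial : ∀ u ∈ Set.Icc (-τ (Fin.last m)) 0, Y u = ξ u
  mem_varHolder : MemVarHolder T α Y
  equation : ∀ t ∈ Set.Icc 0 T,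
    IsYoungIntegral (fun r => f (fun i => Y (r - τ i))) X 0 t (Y t - ξ 0)

/-! Every delay is at least `τ 0 > 0`, so up to time `T' + τ 0` the integrand `f (Y (r - τ i))` only
involves `Y` up to time `T'`. The equation is therefore solved by finitely many explicit
integrations, with no fixed point, and uniqueness follows from the same induction and the uniqueness
of limits of Riemann sums.

What must be shown is that each Young integral exists and stays in the variable order Hölder class.
The germ `G u (X v - X u)` fails to be additive by the product of an increment of `G` and one of
`X`. The increment of `G` has order `α (u - τ i)`, that of `X` has order `α u`, and these sum to at
least `β > 1`; A1 allows the base point of an exponent to move at the cost of a constant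
(`ConditionA1.exists_rpow_le`). Where the delayed times lie in the initial segment, `ξ` is
Lipschitz, and `1 + inf α > 1` serves instead, since A1 and compactness give `inf α > 0`. The case
analysis is `norm_delay_increment_mul_le`. A sewing lemma (`AlmostAdditive.exists_isSewn`,
`AlmostAdditive.norm_isSewn_sub_le`) turns defects of order `θ > 1` into convergence and a local
expansion, from which the integral inherits the regularity of `X`. -/

/-! ### Sewing of almost additive germs -/

/-- Riemann sum of the two-parameter germ `A` along the points `p 0, …, p N`. -/
def germSum {W : Type*} [AddCommMonoid W] (A : ℝ → ℝ → W) (N : ℕ) (p : ℕ → ℝ) : W :=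
  ∑ j ∈ Finset.range N, A (p j) (p (j + 1))

/-- The germ `A` is almost additive of order `θ` on `[a,b]` (on intervals of length at most one). -/
structure AlmostAdditive {W : Type*} [NormedAddCommGroup W] (A : ℝ → ℝ → W) (a b K θ : ℝ) :
    Prop where
  self_eq_zero : ∀ u, A u u = 0
  one_lt : 1 < θ
  nonneg : 0 ≤ K
  bound : ∀ u w v, a ≤ u → u ≤ w → w ≤ v → v ≤ b → v - u ≤ 1 →
    ‖A u v - A u w - A w v‖ ≤ K * (v - u) ^ θ

lemma le_of_le_succ_of_lt {N : ℕ} {p : ℕ → ℝ} (hp : ∀ j < N, p j ≤ p (j + 1)) {i j : ℕ}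
    (hij : i ≤ j) (hj : j ≤ N) : p i ≤ p j := by
  induction j, hij using Nat.le_induction with
  | base => exact le_rfl
  | succ k hk ih => exact (ih (by omega)).trans (hp k (by omega))

lemma germSum_add {W : Type*} [AddCommMonoid W] (A : ℝ → ℝ → W) (N M : ℕ) (p : ℕ → ℝ) :
    germSum A (N + M) p = germSum A N p + germSum A M (fun i => p (N + i)) := by
  simp only [germSum, Finset.sum_range_add, add_assoc]

lemma exists_le_le_succ {N : ℕ} {p : ℕ → ℝ} {c : ℝ} (hN : 0 < N) (h0 : p 0 ≤ c) (h1 : c ≤ p N) :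
    ∃ j < N, p j ≤ c ∧ c ≤ p (j + 1) := by
  by_contra! h
  have key : ∀ j ≤ N, p j ≤ c := by
    intro j
    induction j with
    | zero => exact fun _ => h0
    | succ k ih => exact fun hk => (h k (by omega) (ih (by omega))).le
  have := h (N - 1) (by omega) (key _ (by omega))
  rw [Nat.sub_add_cancel hN] at this
  exact this.not_ge h1

/-- The constant of the sewing estimate. -/
noncomputable def sewingConst (K θ : ℝ) : ℝ := 2 * K / (1 - 2 * (1 / 2 : ℝ) ^ θ)

lemma two_mul_half_rpow_lt_one {θ : ℝ} (hθ : 1 < θ) : 2 * (1 / 2 : ℝ) ^ θ < 1 := by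
  have := Real.rpow_lt_rpow_of_exponent_gt (x := 1 / 2) (by norm_num) (by norm_num) hθ
  rw [Real.rpow_one] at this
  linarith

lemma sewingConst_nonneg {K θ : ℝ} (hK : 0 ≤ K) (hθ : 1 < θ) : 0 ≤ sewingConst K θ :=
  div_nonneg (by positivity) (by linarith [two_mul_half_rpow_lt_one hθ])

/-- The balance that closes the bisection induction: two pieces of at most half the length, plus two
additivity defects. -/
lemma sewingConst_eq {K θ : ℝ} (hθ : 1 < θ) :
    2 * (sewingConst K θ * (1 / 2 : ℝ) ^ θ) + 2 * K = sewingConst K θ := by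
  have : 1 - 2 * (1 / 2 : ℝ) ^ θ ≠ 0 := by linarith [two_mul_half_rpow_lt_one hθ]
  have h : sewingConst K θ * (1 - 2 * (1 / 2 : ℝ) ^ θ) = 2 * K := div_mul_cancel₀ _ this
  linarith

section Sewing

variable {W : Type*} [NormedAddCommGroup W] {A : ℝ → ℝ → W} {a b K θ : ℝ}

/-- Bisection adapted to the partition: the cell containing the midpoint is set apart, so what
remains on either side has at most half the length and falls under the induction hypothesis.
Reassembling the three pieces costs two defects, at `p (j + 1)` and at `p j`. -/
lemma AlmostAdditive.norm_germSum_sub_le (hA : AlmostAdditive A a b K θ) (N : ℕ) :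
    ∀ p : ℕ → ℝ, (∀ j < N, p j ≤ p (j + 1)) → a ≤ p 0 → p N ≤ b → p N - p 0 ≤ 1 →
      ‖germSum A N p - A (p 0) (p N)‖ ≤ sewingConst K θ * (p N - p 0) ^ θ := by
  induction N using Nat.strong_induction_on with
  | _ N ih =>
    intro p hp ha hb h1
    have hθ := hA.one_lt
    have hC := sewingConst_nonneg hA.nonneg hθ
    rcases Nat.eq_zero_or_pos N with rfl | hN
    · simp [germSum, hA.self_eq_zero, Real.zero_rpow (by linarith : θ ≠ 0)]
    have h0N := le_of_le_succ_of_lt hp (Nat.zero_le N) le_rfl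
    obtain ⟨j, hj, hj1, hj2⟩ := exists_le_le_succ (p := p) (c := (p 0 + p N) / 2) hN
      (by linarith) (by linarith)
    obtain ⟨r, rfl⟩ : ∃ r, N = j + 1 + r := ⟨N - (j + 1), by omega⟩
    have h0j := le_of_le_succ_of_lt hp (Nat.zero_le j) (by omega)
    have hjj := hp j (by omega)
    have hjN := le_of_le_succ_of_lt hp (show j + 1 ≤ j + 1 + r by omega) le_rfl
    set q : ℕ → ℝ := fun i => p (j + 1 + i) with hq
    have hL := ih j (by omega) p (fun i hi => hp i (by omega)) ha (by linarith) (by linarith)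
    have hR := ih r (by omega) q (fun i hi => hp (j + 1 + i) (by omega))
      (by simp only [hq, add_zero]; linarith) hb (by simp only [hq, add_zero]; linarith)
    have e0 : q 0 = p (j + 1) := rfl
    have er : q r = p (j + 1 + r) := rfl
    rw [e0, er] at hR
    have hS : germSum A (j + 1 + r) p = germSum A j p + A (p j) (p (j + 1)) + germSum A r q := by
      rw [germSum_add, germSum, Finset.sum_range_succ]; rfl
    set h := p (j + 1 + r) - p 0 with hh
    have hh0 : 0 ≤ h := by linarith
    have hhalf : ∀ x, 0 ≤ x → x ≤ h / 2 →
        sewingConst K θ * x ^ θ ≤ sewingConst K θ * (1 / 2 : ℝ) ^ θ * h ^ θ := by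
      intro x hx hxh
      rw [mul_assoc, ← Real.mul_rpow (by norm_num) hh0]
      exact mul_le_mul_of_nonneg_left
        (Real.rpow_le_rpow hx (by linarith) (by linarith)) hC
    have b1 := hhalf (p j - p 0) (by linarith) (by linarith)
    have b2 := hhalf (p (j + 1 + r) - p (j + 1)) (by linarith) (by linarith)
    have d1 := hA.bound (p 0) (p (j + 1)) (p (j + 1 + r)) ha (by linarith) hjN hb h1
    have d2 := hA.bound (p 0) (p j) (p (j + 1)) ha h0j hjj (by linarith) (by linarith)
    have d3 : K * (p (j + 1) - p 0) ^ θ ≤ K * h ^ θ := mul_le_mul_of_nonneg_left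
      (Real.rpow_le_rpow (by linarith) (by linarith) (by linarith)) hA.nonneg
    have key : germSum A (j + 1 + r) p - A (p 0) (p (j + 1 + r)) =
        (germSum A j p - A (p 0) (p j)) + (germSum A r q - A (p (j + 1)) (p (j + 1 + r)))
        - (A (p 0) (p (j + 1 + r)) - A (p 0) (p (j + 1)) - A (p (j + 1)) (p (j + 1 + r)))
        - (A (p 0) (p (j + 1)) - A (p 0) (p j) - A (p j) (p (j + 1))) := by
      rw [hS]; abel
    have hc := congrArg (· * h ^ θ) (sewingConst_eq (K := K) hθ)
    simp only [add_mul] at hc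
    rw [key]
    refine (norm_sub_le _ _).trans ?_
    refine (add_le_add_left ((norm_sub_le _ _).trans
      (add_le_add_left (norm_add_le _ _) _)) _).trans ?_
    linarith

/-- Projection of `s` to the interval `[x,y]`. -/
noncomputable def clampTo (x y s : ℝ) : ℝ := max x (min s y)

/-- If the intervals overlap, both sides are the germ on their intersection; otherwise both
intervals collapse to points and the germ vanishes. Hence the common refinement of two partitions is
a double sum symmetric in them, and no sorting of points is needed. -/
lemma germ_clampTo_symm {A : ℝ → ℝ → W} (h0 : ∀ u, A u u = 0) {x y s t : ℝ} (hxy : x ≤ y)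
    (hst : s ≤ t) :
    A (clampTo x y s) (clampTo x y t) = A (clampTo s t x) (clampTo s t y) := by
  unfold clampTo
  rcases le_total y s with h | h
  · rw [min_eq_right h, min_eq_right (h.trans hst), max_eq_right hxy, h0,
      min_eq_left (h.trans hst), max_eq_left h, min_eq_left (hxy.trans (h.trans hst)),
      max_eq_left (hxy.trans h), h0]
  rcases le_total t x with h' | h'
  · rw [min_eq_left h, min_eq_left (h'.trans hxy), max_eq_left h', max_eq_left (hst.trans h'), h0,
      min_eq_right h', min_eq_right (h'.trans hxy), h0]
  rw [min_eq_left h, min_eq_left h', max_comm x s, max_eq_right (le_min h' hxy),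
    max_eq_right (le_min h hst), min_comm]

lemma clampTo_mono {x y s t : ℝ} (h : s ≤ t) : clampTo x y s ≤ clampTo x y t :=
  max_le_max le_rfl (min_le_min h le_rfl)

/-- Refining one cell of length `l < δ` costs a multiple of `l ^ θ ≤ δ ^ (θ - 1) * l`, and the
lengths add up to `b - a`. -/
lemma AlmostAdditive.norm_germSum_sub_sum_clampTo_le (hA : AlmostAdditive A a b K θ) {δ : ℝ}
    (hδ : δ ≤ 1) {N M : ℕ} {p q : ℕ → ℝ} (hp : IsFinePartition a b δ N p)
    (hq : ∀ j < M, q j ≤ q (j + 1)) (hq0 : q 0 = a) (hqM : q M = b) :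
    ‖germSum A N p - ∑ j ∈ Finset.range N, ∑ k ∈ Finset.range M,
      A (clampTo (p j) (p (j + 1)) (q k)) (clampTo (p j) (p (j + 1)) (q (k + 1)))‖ ≤
      sewingConst K θ * δ ^ (θ - 1) * (b - a) := by
  obtain ⟨hp0, hpN, hpj⟩ := hp
  have hθ := hA.one_lt
  have hC := sewingConst_nonneg hA.nonneg hθ
  have hmono : ∀ j < N, p j ≤ p (j + 1) := fun j hj => (hpj j hj).1
  have hba : b - a = ∑ j ∈ Finset.range N, (p (j + 1) - p j) := by
    rw [Finset.sum_range_sub, hp0, hpN]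
  rw [germSum, ← Finset.sum_sub_distrib, hba, Finset.mul_sum]
  refine (norm_sum_le _ _).trans (Finset.sum_le_sum fun j hj => ?_)
  rw [Finset.mem_range] at hj
  have haj : a ≤ p j := hp0 ▸ le_of_le_succ_of_lt hmono (Nat.zero_le j) hj.le
  have hjb : p (j + 1) ≤ b := hpN ▸ le_of_le_succ_of_lt hmono (Nat.succ_le_of_lt hj) le_rfl
  obtain ⟨hjj, hjδ⟩ := hpj j hj
  have e0 : clampTo (p j) (p (j + 1)) (q 0) = p j := by
    rw [hq0, clampTo, min_eq_left (haj.trans hjj), max_eq_left haj]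
  have eM : clampTo (p j) (p (j + 1)) (q M) = p (j + 1) := by
    rw [hqM, clampTo, min_eq_right hjb, max_eq_right hjj]
  have := hA.norm_germSum_sub_le M (fun k => clampTo (p j) (p (j + 1)) (q k))
    (fun k hk => clampTo_mono (hq k hk)) (by simp only [e0]; exact haj)
    (by simp only [eM]; exact hjb) (by simp only [e0, eM]; linarith)
  simp only [e0, eM] at this
  rw [norm_sub_rev]
  refine this.trans ?_
  rw [mul_assoc]
  refine mul_le_mul_of_nonneg_left ?_ hC
  rcases hjj.eq_or_lt with h | h
  · simp [h, Real.zero_rpow (by linarith : θ ≠ 0)]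
  · have hpos : 0 < p (j + 1) - p j := by linarith
    calc (p (j + 1) - p j) ^ θ = (p (j + 1) - p j) ^ (θ - 1) * (p (j + 1) - p j) := by
          rw [← Real.rpow_add_one hpos.ne']; ring_nf
      _ ≤ _ := mul_le_mul_of_nonneg_right
          (Real.rpow_le_rpow hpos.le hjδ.le (by linarith)) hpos.le

lemma AlmostAdditive.norm_germSum_sub_germSum_le (hA : AlmostAdditive A a b K θ) {δ : ℝ}
    (hδ : δ ≤ 1) {N M : ℕ} {p q : ℕ → ℝ} (hp : IsFinePartition a b δ N p)
    (hq : IsFinePartition a b δ M q) :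
    ‖germSum A N p - germSum A M q‖ ≤ 2 * (sewingConst K θ * δ ^ (θ - 1) * (b - a)) := by
  have h1 := hA.norm_germSum_sub_sum_clampTo_le hδ hp (fun j hj => (hq.2.2 j hj).1) hq.1 hq.2.1
  have h2 := hA.norm_germSum_sub_sum_clampTo_le hδ hq (fun j hj => (hp.2.2 j hj).1) hp.1 hp.2.1
  rw [Finset.sum_comm, Finset.sum_congr rfl fun j hj => Finset.sum_congr rfl fun k hk =>
    germ_clampTo_symm hA.self_eq_zero (hq.2.2 k (Finset.mem_range.1 hk)).1
      (hp.2.2 j (Finset.mem_range.1 hj)).1] at h2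
  have := norm_sub_le_norm_sub_add_norm_sub (germSum A N p) (∑ j ∈ Finset.range N,
    ∑ k ∈ Finset.range M, A (clampTo (p j) (p (j + 1)) (q k))
      (clampTo (p j) (p (j + 1)) (q (k + 1)))) (germSum A M q)
  rw [norm_sub_rev] at h2
  linarith

/-- `I` is the limit of the sums of the germ `A` over partitions of `[a,b]`. -/
def IsSewn (A : ℝ → ℝ → W) (a b : ℝ) (I : W) : Prop :=
  ∀ ε > 0, ∃ δ > 0, ∀ (N : ℕ) (p : ℕ → ℝ), IsFinePartition a b δ N p → ‖germSum A N p - I‖ < ε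

lemma IsFinePartition.mono {δ δ' : ℝ} {N : ℕ} {p : ℕ → ℝ} (h : IsFinePartition a b δ N p)
    (hδ : δ ≤ δ') : IsFinePartition a b δ' N p :=
  ⟨h.1, h.2.1, fun j hj => ⟨(h.2.2 j hj).1, (h.2.2 j hj).2.trans_le hδ⟩⟩

lemma exists_isFinePartition (hab : a ≤ b) {δ : ℝ} (hδ : 0 < δ) :
    ∃ N p, IsFinePartition a b δ N p := by
  obtain ⟨N, hN⟩ := exists_nat_gt ((b - a) / δ)
  have hN0 : (0 : ℝ) < N := (div_nonneg (by linarith) hδ.le).trans_lt hN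
  rw [div_lt_iff₀ hδ] at hN
  refine ⟨N, fun j => a + j * ((b - a) / N), by simp, by field_simp; ring, fun j _ => ?_⟩
  have h1 : 0 ≤ (b - a) / N := div_nonneg (by linarith) hN0.le
  have h2 : (b - a) / N < δ := by rw [div_lt_iff₀ hN0]; linarith
  push_cast
  constructor <;> linarith

lemma IsFinePartition.concat {c δ : ℝ} {N M : ℕ} {p q : ℕ → ℝ} (hp : IsFinePartition a b δ N p)
    (hq : IsFinePartition b c δ M q) (A : ℝ → ℝ → W) :
    ∃ r, IsFinePartition a c δ (N + M) r ∧
      germSum A (N + M) r = germSum A N p + germSum A M q := by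
  set r : ℕ → ℝ := fun j => if j ≤ N then p j else q (j - N) with hr
  have hr1 : ∀ j ≤ N, r j = p j := fun j hj => by simp [hr, hj]
  have hr2 : ∀ j, r (N + j) = q j := fun j => by
    rcases Nat.eq_zero_or_pos j with rfl | hj
    · simp [hr, hp.2.1, hq.1]
    · simp [hr, hj.ne']
  refine ⟨r, ⟨(hr1 0 (Nat.zero_le _)).trans hp.1, (hr2 M).trans hq.2.1, fun j hj => ?_⟩, ?_⟩
  · rcases lt_or_ge j N with h | h
    · rw [hr1 j h.le, hr1 (j + 1) h]; exact hp.2.2 j h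
    · obtain ⟨k, rfl⟩ := Nat.exists_eq_add_of_le h
      rw [add_assoc, hr2, hr2]; exact hq.2.2 k (by omega)
  · rw [germSum_add]
    congr 1
    · exact Finset.sum_congr rfl fun j hj => by
        rw [hr1 j (Finset.mem_range.1 hj).le, hr1 (j + 1) (Finset.mem_range.1 hj)]
    · exact Finset.sum_congr rfl fun j _ => by simp only [hr2]

lemma IsSewn.unique (hab : a ≤ b) {I J : W} (hI : IsSewn A a b I) (hJ : IsSewn A a b J) :
    I = J := by
  refine eq_of_forall_dist_le fun ε hε => ?_
  obtain ⟨δ, hδ, h⟩ := hI (ε / 2) (by linarith)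
  obtain ⟨δ', hδ', h'⟩ := hJ (ε / 2) (by linarith)
  obtain ⟨N, p, hp⟩ := exists_isFinePartition hab (lt_min hδ hδ')
  have h1 := h N p (hp.mono (min_le_left _ _))
  have h2 := h' N p (hp.mono (min_le_right _ _))
  rw [dist_eq_norm]
  have := norm_sub_le_norm_sub_add_norm_sub I (germSum A N p) J
  rw [norm_sub_rev] at h1
  linarith

lemma AlmostAdditive.exists_isSewn [CompleteSpace W] (hA : AlmostAdditive A a b K θ)
    (hab : a ≤ b) : ∃ I, IsSewn A a b I := by
  have hθ := hA.one_lt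
  have hlim : Filter.Tendsto (fun δ : ℝ => 2 * (sewingConst K θ * δ ^ (θ - 1) * (b - a)))
      (nhds 0) (nhds 0) := by
    have : ContinuousAt (fun δ : ℝ => 2 * (sewingConst K θ * δ ^ (θ - 1) * (b - a))) 0 := by
      have := Real.continuousAt_rpow_const 0 (θ - 1) (Or.inr (by linarith))
      fun_prop
    simpa [ContinuousAt, Real.zero_rpow (by linarith : θ - 1 ≠ 0)] using this
  have hsmall : ∀ ε > 0, ∃ δ > 0, ∀ N M p q, IsFinePartition a b δ N p →
      IsFinePartition a b δ M q → ‖germSum A N p - germSum A M q‖ < ε := by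
    intro ε hε
    obtain ⟨δ, hδ, h⟩ := Metric.tendsto_nhds_nhds.1 hlim ε hε
    -- The cap `1` is the range of the sewing estimate; halving `δ` makes the distance to `0`
    -- strictly smaller than `δ`.
    have hm : 0 < min (δ / 2) 1 := lt_min (by linarith) one_pos
    refine ⟨min (δ / 2) 1, hm, fun N M p q hp hq => ?_⟩
    refine (hA.norm_germSum_sub_germSum_le (min_le_right _ _) hp hq).trans_lt ?_
    have := h (x := min (δ / 2) 1) (by
      rw [dist_zero_right, Real.norm_of_nonneg hm.le]; linarith [min_le_left (δ / 2) 1])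
    rw [dist_zero_right] at this
    exact (le_abs_self _).trans_lt this
  choose N p hp using fun k : ℕ => exists_isFinePartition hab (Nat.one_div_pos_of_nat (n := k))
  have hfine : ∀ δ > 0, ∃ k, ∀ l ≥ k, IsFinePartition a b δ (N l) (p l) := by
    intro δ hδ
    obtain ⟨k, hk⟩ := exists_nat_one_div_lt hδ
    exact ⟨k, fun l hl => (hp l).mono ((Nat.one_div_le_one_div hl).trans hk.le)⟩
  have hcau : CauchySeq fun k => germSum A (N k) (p k) := by
    refine Metric.cauchySeq_iff.2 fun ε hε => ?_
    obtain ⟨δ, hδ, h⟩ := hsmall ε hε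
    obtain ⟨k, hk⟩ := hfine δ hδ
    exact ⟨k, fun i hi j hj => by rw [dist_eq_norm]; exact h _ _ _ _ (hk i hi) (hk j hj)⟩
  obtain ⟨I, hI⟩ := cauchySeq_tendsto_of_complete hcau
  refine ⟨I, fun ε hε => ?_⟩
  obtain ⟨δ, hδ, h⟩ := hsmall (ε / 2) (by linarith)
  refine ⟨δ, hδ, fun M q hq => ?_⟩
  obtain ⟨k, hk⟩ := hfine δ hδ
  obtain ⟨k', hk'⟩ := Metric.tendsto_atTop.1 hI (ε / 2) (by linarith)
  have h1 := h _ _ _ _ hq (hk (max k k') (le_max_left _ _))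
  have h2 := hk' (max k k') (le_max_right _ _)
  rw [dist_eq_norm] at h2
  have := norm_sub_le_norm_sub_add_norm_sub (germSum A M q)
    (germSum A (N (max k k')) (p (max k k'))) I
  linarith

lemma AlmostAdditive.norm_isSewn_sub_le (hA : AlmostAdditive A a b K θ) {u v : ℝ} (hau : a ≤ u)
    (huv : u ≤ v) (hvb : v ≤ b) (h1 : v - u ≤ 1) {I J : W} (hI : IsSewn A a u I)
    (hJ : IsSewn A a v J) : ‖J - I - A u v‖ ≤ sewingConst K θ * (v - u) ^ θ := by
  refine le_of_forall_pos_le_add fun ε hε => ?_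
  obtain ⟨δ, hδ, h⟩ := hI (ε / 2) (by linarith)
  obtain ⟨δ', hδ', h'⟩ := hJ (ε / 2) (by linarith)
  obtain ⟨N, p, hp⟩ := exists_isFinePartition hau (lt_min hδ hδ')
  obtain ⟨M, q, hq⟩ := exists_isFinePartition huv (lt_min hδ hδ')
  obtain ⟨r, hr, hsum⟩ := hp.concat hq A
  have e1 := h N p (hp.mono (min_le_left _ _))
  have e2 := h' _ r (hr.mono (min_le_right _ _))
  have e3 := hA.norm_germSum_sub_le M q (fun j hj => (hq.2.2 j hj).1)
    (by rw [hq.1]; exact hau) (by rw [hq.2.1]; exact hvb) (by rw [hq.1, hq.2.1]; exact h1)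
  rw [hq.1, hq.2.1] at e3
  have key : J - I - A u v = (germSum A M q - A u v) + (germSum A N p - I)
      - (germSum A (N + M) r - J) := by rw [hsum]; abel
  rw [key]
  refine (norm_sub_le _ _).trans ((add_le_add_left (norm_add_le _ _) _).trans ?_)
  linarith

lemma AlmostAdditive.mono (hA : AlmostAdditive A a b K θ) {c : ℝ} (hc : c ≤ b) :
    AlmostAdditive A a c K θ :=
  ⟨hA.self_eq_zero, hA.one_lt, hA.nonneg,
    fun u w v h1 h2 h3 h4 => hA.bound u w v h1 h2 h3 (h4.trans hc)⟩

end Sewing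

/-! ### Variable exponents and increment estimates -/

/-- Only `α t < α s` needs A1: the exponent `α t - α s` is then negative, so passing from `h` down
to `|t - s|` increases the power, and A1 bounds the result. -/
lemma ConditionA1.exists_rpow_le {T : ℝ} {α : ℝ → ℝ} (hA1 : ConditionA1 T α) :
    ∃ C : ℝ, 1 ≤ C ∧ ∀ s ∈ Set.Icc 0 T, ∀ t ∈ Set.Icc 0 T, ∀ h : ℝ, 0 < h → h ≤ 1 →
      |t - s| ≤ h → h ^ α t ≤ C * h ^ α s := by
  obtain ⟨C, hC⟩ := hA1
  refine ⟨max C 1, le_max_right _ _, fun s hs t ht h h0 h1 hst => ?_⟩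
  have hpos : 0 < h ^ α s := Real.rpow_pos_of_pos h0 _
  rcases le_or_gt (α s) (α t) with hle | hlt
  · exact (Real.rpow_le_rpow_of_exponent_ge h0 h1 hle).trans
      (le_mul_of_one_le_left hpos.le (le_max_right _ _))
  · have hne : 0 < |s - t| := abs_pos.2 (sub_ne_zero.2 fun e => by simp [e] at hlt)
    rw [abs_sub_comm] at hst
    have h2 := hC t ht (s - t) (hst.trans h1) (by simpa using hs)
    rw [add_sub_cancel] at h2
    have h3 := Real.rpow_le_rpow_of_nonpos hne hst (z := α t - α s) (by linarith)
    calc h ^ α t = h ^ (α t - α s) * h ^ α s := by rw [← Real.rpow_add h0, sub_add_cancel]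
      _ ≤ _ := mul_le_mul_of_nonneg_right ((h3.trans h2).trans (le_max_left _ _)) hpos.le

/-- Near each `t` one has `α s ≥ α t / 2`: otherwise moving the exponent from `s` to `t` gives `|s -
t| ^ α s ≤ C * |s - t| ^ (α t / 2) * |s - t| ^ α s`, impossible once `C * |s - t| ^ (α t / 2) < 1`.
Compactness makes the bound uniform. -/
lemma ConditionA1.exists_pos_le {T : ℝ} {α : ℝ → ℝ} (hA1 : ConditionA1 T α)
    (hα : ∀ t ∈ Set.Icc 0 T, 0 < α t) : ∃ c > 0, ∀ t ∈ Set.Icc 0 T, c ≤ α t := by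
  obtain ⟨C, hC1, hC⟩ := hA1.exists_rpow_le
  refine isCompact_Icc.induction_on (p := fun S => ∃ c > 0, ∀ t ∈ S, c ≤ α t)
    ⟨1, one_pos, by simp⟩ ?_ ?_ fun t ht => ?_
  · exact fun S S' hS ⟨c, hc, h⟩ => ⟨c, hc, fun t ht => h t (hS ht)⟩
  · rintro S S' ⟨c, hc, h⟩ ⟨c', hc', h'⟩
    refine ⟨min c c', lt_min hc hc', fun t ht => ?_⟩
    rcases ht with ht | ht
    · exact (min_le_left _ _).trans (h t ht)
    · exact (min_le_right _ _).trans (h' t ht)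
  · have ht0 := hα t ht
    have hcont : ContinuousAt (fun s : ℝ => C * |s - t| ^ (α t / 2)) t :=
      continuousAt_const.mul (ContinuousAt.rpow_const (by fun_prop) (Or.inr (by linarith)))
    have hev : ∀ᶠ s in nhds t, C * |s - t| ^ (α t / 2) < 1 :=
      hcont.eventually_lt continuousAt_const (by
        simp [Real.zero_rpow (by linarith : α t / 2 ≠ 0)])
    have hev1 : ∀ᶠ s in nhds t, |s - t| < 1 :=
      ContinuousAt.eventually_lt (by fun_prop) continuousAt_const (by simp)
    refine ⟨{s | s ∈ Set.Icc 0 T ∧ C * |s - t| ^ (α t / 2) < 1 ∧ |s - t| < 1}, ?_, α t / 2,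
      by linarith, ?_⟩
    · filter_upwards [self_mem_nhdsWithin, nhdsWithin_le_nhds hev, nhdsWithin_le_nhds hev1]
        with s h1 h2 h3 using ⟨h1, h2, h3⟩
    · rintro s ⟨hs, h2, h3⟩
      by_contra! hlt
      have hne : 0 < |s - t| := abs_pos.2 (sub_ne_zero.2 fun e => by rw [e] at hlt; linarith)
      have h4 := hC t ht s hs |s - t| hne h3.le le_rfl
      have hpos := Real.rpow_pos_of_pos hne (α s)
      have h5 : |s - t| ^ α t ≤ |s - t| ^ (α t / 2) * |s - t| ^ α s := by
        rw [← Real.rpow_add hne]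
        exact Real.rpow_le_rpow_of_exponent_ge hne h3.le (by linarith)
      have h6 : C * |s - t| ^ α t ≤ C * |s - t| ^ (α t / 2) * |s - t| ^ α s := by
        rw [mul_assoc]; exact mul_le_mul_of_nonneg_left h5 (by linarith)
      nlinarith

lemma IsCb2.exists_bound_lipschitz {E F : Type*} [NormedAddCommGroup E] [NormedSpace ℝ E]
    [NormedAddCommGroup F] [NormedSpace ℝ F] {f : E → F} (hf : IsCb2 f) :
    ∃ M L : ℝ, 0 ≤ M ∧ 0 ≤ L ∧ (∀ x, ‖f x‖ ≤ M) ∧ ∀ x y, ‖f x - f y‖ ≤ L * ‖x - y‖ := by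
  obtain ⟨M, hM⟩ := hf.2 0 (by norm_num)
  obtain ⟨L, hL⟩ := hf.2 1 (by norm_num)
  simp only [norm_iteratedFDeriv_zero] at hM
  simp only [norm_iteratedFDeriv_one] at hL
  refine ⟨M, L, (norm_nonneg _).trans (hM 0), (norm_nonneg _).trans (hL 0), hM, fun x y => ?_⟩
  exact convex_univ.norm_image_sub_le_of_norm_fderiv_le
    (fun z _ => (hf.1.differentiable (by norm_num)) z) (fun z _ => hL z) (Set.mem_univ y)
    (Set.mem_univ x)

lemma ContDiffOn.exists_norm_sub_le_Icc {E : Type*} [NormedAddCommGroup E] [NormedSpace ℝ E]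
    {g : ℝ → E} {a b : ℝ} (hab : a < b) (hg : ContDiffOn ℝ 1 g (Set.Icc a b)) :
    ∃ L : ℝ, 0 ≤ L ∧ ∀ x ∈ Set.Icc a b, ∀ y ∈ Set.Icc a b, ‖g x - g y‖ ≤ L * |x - y| := by
  have hc := hg.continuousOn_derivWithin (uniqueDiffOn_Icc hab) le_rfl
  obtain ⟨L, hL⟩ := isCompact_Icc.exists_bound_of_continuousOn hc
  refine ⟨L, (norm_nonneg _).trans (hL a (Set.left_mem_Icc.2 hab.le)), fun x hx y hy => ?_⟩
  exact (convex_Icc a b).norm_image_sub_le_of_norm_derivWithin_le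
    (hg.differentiableOn one_ne_zero) hL hy hx

lemma MemVarHolder.exists_norm_sub_le {E : Type*} [NormedAddCommGroup E] {T : ℝ} {α : ℝ → ℝ}
    {g : ℝ → E} (hg : MemVarHolder T α g) :
    ∃ C : ℝ, 0 ≤ C ∧ ∀ s ∈ Set.Icc 0 T, ∀ t ∈ Set.Icc 0 T, |t - s| ≤ 1 →
      ‖g t - g s‖ ≤ C * |t - s| ^ α s := by
  obtain ⟨C, hC⟩ := hg
  refine ⟨max C 0, le_max_right _ _, fun s hs t ht h => ?_⟩
  have := hC s hs (t - s) h (by simpa using ht)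
  rw [add_sub_cancel] at this
  exact this.trans (mul_le_mul_of_nonneg_right (le_max_left _ _) (by positivity))

lemma memVarHolder_of_le {E : Type*} [NormedAddCommGroup E] {T : ℝ} {α : ℝ → ℝ} {g : ℝ → E}
    (C : ℝ) (h : ∀ s ∈ Set.Icc 0 T, ∀ t ∈ Set.Icc 0 T, s ≤ t → t - s ≤ 1 →
      ‖g t - g s‖ ≤ C * (t - s) ^ α s ∧ ‖g t - g s‖ ≤ C * (t - s) ^ α t) :
    MemVarHolder T α g := by
  refine ⟨C, fun t ht h' h1 hth => ?_⟩
  rcases le_total 0 h' with h0 | h0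
  · have := (h t ht (t + h') hth (by linarith) (by rw [abs_of_nonneg h0] at h1; linarith)).1
    rwa [add_sub_cancel_left, ← congrArg (· ^ α t) (abs_of_nonneg h0)] at this
  · have := (h (t + h') hth t ht (by linarith) (by rw [abs_of_nonpos h0] at h1; linarith)).2
    rwa [sub_add_cancel_left, ← abs_of_nonpos h0, norm_sub_rev] at this

lemma norm_delay_increment_mul_le {E F : Type*} [NormedAddCommGroup E] [NormedAddCommGroup F]
    {T T' σ β a₀ θ C CX CY L : ℝ} {α : ℝ → ℝ} {X : ℝ → F} {Y : ℝ → E}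
    (hσ : 0 < σ) (hT' : 0 ≤ T')
    (hα : ∀ t ∈ Set.Icc 0 T, α t ∈ Set.Icc 0 1)
    (ha₀ : ∀ t ∈ Set.Icc 0 T, a₀ ≤ α t)
    (hβ : ∀ t ∈ Set.Icc σ T, β ≤ α t + α (t - σ)) (hθβ : θ ≤ β) (hθa : θ ≤ 1 + a₀)
    (hC1 : 1 ≤ C) (hC : ∀ s ∈ Set.Icc 0 T, ∀ t ∈ Set.Icc 0 T, ∀ h : ℝ, 0 < h → h ≤ 1 →
      |t - s| ≤ h → h ^ α t ≤ C * h ^ α s)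
    (hCX : 0 ≤ CX) (hX : ∀ s ∈ Set.Icc 0 T, ∀ t ∈ Set.Icc 0 T, |t - s| ≤ 1 →
      ‖X t - X s‖ ≤ CX * |t - s| ^ α s)
    (hCY : 0 ≤ CY) (hY : ∀ s ∈ Set.Icc 0 T', ∀ t ∈ Set.Icc 0 T', |t - s| ≤ 1 →
      ‖Y t - Y s‖ ≤ CY * |t - s| ^ α s)
    (hL0 : 0 ≤ L) (hL : ∀ x ∈ Set.Icc (-σ) 0, ∀ y ∈ Set.Icc (-σ) 0, ‖Y x - Y y‖ ≤ L * |x - y|)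
    {u w v : ℝ} (hu : 0 ≤ u) (huw : u ≤ w) (hwv : w ≤ v) (hvT : v ≤ T) (hvT' : v ≤ T' + σ)
    (huv : v - u ≤ 1) :
    ‖Y (w - σ) - Y (u - σ)‖ * ‖X v - X w‖ ≤ CX * C * (CY + L) * (v - u) ^ θ := by
  have hK : 0 ≤ CX * C * (CY + L) := by positivity
  rcases (huw.trans hwv).eq_or_lt with huv' | huv'
  · obtain rfl : u = w := le_antisymm huw (huv' ▸ hwv)
    simp only [sub_self, norm_zero, zero_mul]
    exact mul_nonneg hK (Real.rpow_nonneg (by linarith) _)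
  set h := v - u with hh
  have h0 : 0 < h := by linarith
  have hw : w ∈ Set.Icc 0 T := ⟨by linarith, by linarith⟩
  have hpow : ∀ e : ℝ, 0 ≤ e → ∀ x, 0 ≤ x → x ≤ h → x ^ e ≤ h ^ e := fun e he x hx hxh =>
    Real.rpow_le_rpow hx hxh he
  have hXw : ‖X v - X w‖ ≤ CX * h ^ α w := by
    refine (hX w hw v ⟨by linarith, hvT⟩ ?_).trans ?_
    · rw [abs_of_nonneg (by linarith)]; linarith
    · rw [abs_of_nonneg (by linarith)]
      exact mul_le_mul_of_nonneg_left (hpow _ (hα w hw).1 _ (by linarith) (by linarith)) hCX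
  suffices H : ∃ e e', θ ≤ e + e' ∧ ‖Y (w - σ) - Y (u - σ)‖ ≤ (CY + L) * h ^ e ∧
      h ^ α w ≤ C * h ^ e' by
    obtain ⟨e, e', hee, h1, h2⟩ := H
    have h3 : h ^ e * h ^ e' ≤ h ^ θ := by
      rw [← Real.rpow_add h0]
      exact Real.rpow_le_rpow_of_exponent_ge h0 huv hee
    calc _ ≤ ((CY + L) * h ^ e) * (CX * h ^ α w) :=
          mul_le_mul h1 hXw (norm_nonneg _) (by positivity)
      _ ≤ ((CY + L) * h ^ e) * (CX * (C * h ^ e')) := by gcongr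
      _ = CX * C * (CY + L) * (h ^ e * h ^ e') := by ring
      _ ≤ _ := mul_le_mul_of_nonneg_left h3 hK
  -- Both delayed times are nonnegative: the exponents are taken at `u - σ` and `u`.
  rcases le_total σ u with hσu | hσu
  · have hu' : u ∈ Set.Icc σ T := ⟨hσu, by linarith⟩
    have hα0 := (hα (u - σ) ⟨by linarith, by linarith⟩).1
    refine ⟨α (u - σ), α u, by linarith [hβ u hu'], ?_, hC u ⟨hu, hu'.2⟩ w hw h h0 huv ?_⟩
    · have := hY (u - σ) ⟨by linarith, by linarith⟩ (w - σ) ⟨by linarith, by linarith⟩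
        (by rw [abs_of_nonneg (by linarith)]; linarith)
      rw [abs_of_nonneg (by linarith)] at this
      refine this.trans (mul_le_mul (by linarith) ?_ ?_ (by linarith))
      · exact hpow _ hα0 _ (by linarith) (by linarith)
      · exact Real.rpow_nonneg (by linarith) _
    · rw [abs_of_nonneg (by linarith)]; linarith
  -- Both delayed times lie in the initial segment: order `1` from the Lipschitz bound, `a₀` from
  -- `X`.
  rcases le_total w σ with hwσ | hσw
  · refine ⟨1, a₀, hθa, ?_, ?_⟩
    · rw [Real.rpow_one]
      refine (hL (w - σ) ⟨by linarith, by linarith⟩ (u - σ) ⟨by linarith, by linarith⟩).trans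
        (mul_le_mul (by linarith) ?_ (abs_nonneg _) (by linarith))
      rw [abs_of_nonneg (by linarith)]; linarith
    · exact (Real.rpow_le_rpow_of_exponent_ge h0 huv (ha₀ w hw)).trans
        (le_mul_of_one_le_left (Real.rpow_nonneg h0.le _) hC1)
  -- The delayed times straddle `0`: the increment is cut at `Y 0`, and the hypothesis on `β` is
  -- used at time `σ`, with exponents `α 0` and `α σ`.
  · have hσ' : σ ∈ Set.Icc σ T := ⟨le_rfl, by linarith⟩
    have h00 := hα 0 ⟨le_rfl, by linarith⟩
    refine ⟨α 0, α σ, ?_, ?_, hC σ ⟨hσ.le, hσ'.2⟩ w hw h h0 huv ?_⟩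
    · have := hβ σ hσ'
      rw [sub_self] at this
      linarith
    · have h1 := hY 0 ⟨le_rfl, hT'⟩ (w - σ) ⟨by linarith, by linarith⟩
        (by rw [abs_of_nonneg (by linarith)]; linarith)
      rw [abs_of_nonneg (by linarith), sub_zero] at h1
      have h2 := hL 0 ⟨by linarith, le_rfl⟩ (u - σ) ⟨by linarith, by linarith⟩
      rw [abs_of_nonneg (by linarith)] at h2
      have h3 : 0 - (u - σ) ≤ h ^ α 0 := by
        have := Real.rpow_le_rpow_of_exponent_ge h0 huv h00.2
        rw [Real.rpow_one] at this
        linarith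
      have h4 := hpow _ h00.1 (w - σ) (by linarith) (by linarith)
      refine (norm_sub_le_norm_sub_add_norm_sub _ (Y 0) _).trans ?_
      rw [add_mul]
      exact add_le_add (h1.trans (mul_le_mul_of_nonneg_left h4 hCY))
        (h2.trans (mul_le_mul_of_nonneg_left h3 hL0))
    · rw [abs_of_nonneg (by linarith)]; linarith

/-! ### Young integrals -/

lemma IsYoungIntegral.congr {V W : Type*} [NormedAddCommGroup V] [NormedSpace ℝ V]
    [NormedAddCommGroup W] [NormedSpace ℝ W] {G G' : ℝ → V →L[ℝ] W} {X : ℝ → V} {a b : ℝ} {I : W}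
    (hI : IsYoungIntegral G X a b I) (h : ∀ r ∈ Set.Icc a b, G r = G' r) :
    IsYoungIntegral G' X a b I := by
  intro ε hε
  obtain ⟨δ, hδ, H⟩ := hI ε hε
  refine ⟨δ, hδ, fun N p hp => ?_⟩
  convert H N p hp using 3
  refine Finset.sum_congr rfl fun j hj => ?_
  rw [Finset.mem_range] at hj
  have hmono : ∀ j < N, p j ≤ p (j + 1) := fun j hj => (hp.2.2 j hj).1
  rw [h (p j) ⟨hp.1 ▸ le_of_le_succ_of_lt hmono (Nat.zero_le j) hj.le,
    hp.2.1 ▸ le_of_le_succ_of_lt hmono hj.le le_rfl⟩]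

/-- The germ `G_u (X_v - X_u)` of the Young integral. -/
def youngGerm {V W : Type*} [NormedAddCommGroup V] [NormedSpace ℝ V]
    [NormedAddCommGroup W] [NormedSpace ℝ W] (G : ℝ → V →L[ℝ] W) (X : ℝ → V) (u v : ℝ) : W :=
  G u (X v - X u)

lemma IsYoungIntegral.unique {V W : Type*} [NormedAddCommGroup V] [NormedSpace ℝ V]
    [NormedAddCommGroup W] [NormedSpace ℝ W] {G : ℝ → V →L[ℝ] W} {X : ℝ → V} {a b : ℝ}
    (hab : a ≤ b) {I J : W} (hI : IsYoungIntegral G X a b I) (hJ : IsYoungIntegral G X a b J) :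
    I = J :=
  IsSewn.unique (A := youngGerm G X) hab hI hJ

/-- The sewing remainder has order `θ > 1 ≥ α`, so the leading term `G s (X t - X s)` dictates the
regularity. -/
lemma MemVarHolder.youngIntegral {V W : Type*} [NormedAddCommGroup V] [NormedSpace ℝ V]
    [NormedAddCommGroup W] [NormedSpace ℝ W] {G : ℝ → V →L[ℝ] W} {X : ℝ → V} {T K θ M : ℝ}
    {α : ℝ → ℝ} {I : ℝ → W} (hX : MemVarHolder T α X) (hα : ∀ t ∈ Set.Icc 0 T, α t ≤ 1)
    (hA : AlmostAdditive (youngGerm G X) 0 T K θ) (hM : 0 ≤ M) (hG : ∀ r, ‖G r‖ ≤ M)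
    (hI : ∀ t ∈ Set.Icc 0 T, IsYoungIntegral G X 0 t (I t)) : MemVarHolder T α I := by
  obtain ⟨C, hC0, hC⟩ := hX.exists_norm_sub_le
  have hθ := hA.one_lt
  have hS := sewingConst_nonneg hA.nonneg hθ
  -- The exponent sits at a free point `r`, to be taken at either end: `r = s` for forward and `r =
  -- t` for backward increments.
  have key : ∀ r ∈ Set.Icc 0 T, ∀ s ∈ Set.Icc 0 T, ∀ t ∈ Set.Icc 0 T, s ≤ t → t - s ≤ 1 →
      ‖X t - X s‖ ≤ C * (t - s) ^ α r →
      ‖I t - I s‖ ≤ (sewingConst K θ + M * C) * (t - s) ^ α r := by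
    intro r hr s hs t ht hst h1 hXst
    have h2 := hA.norm_isSewn_sub_le hs.1 hst ht.2 h1 (hI s hs) (hI t ht)
    rcases hst.eq_or_lt with rfl | hlt
    · simpa using mul_nonneg (add_nonneg hS (mul_nonneg hM hC0)) (Real.rpow_nonneg le_rfl (α r))
    have h3 : (t - s) ^ θ ≤ (t - s) ^ α r :=
      Real.rpow_le_rpow_of_exponent_ge (by linarith) h1 (by linarith [hα r hr])
    have h4 : ‖youngGerm G X s t‖ ≤ M * (C * (t - s) ^ α r) :=
      ((G s).le_opNorm _).trans (mul_le_mul (hG s) hXst (norm_nonneg _) hM)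
    have h5 := norm_sub_norm_le (I t - I s) (youngGerm G X s t)
    have h6 := mul_le_mul_of_nonneg_left h3 hS
    rw [add_mul, mul_assoc]
    linarith
  refine memVarHolder_of_le (sewingConst K θ + M * C) fun s hs t ht hst h1 => ⟨?_, ?_⟩
  · refine key s hs s hs t ht hst h1 ?_
    have := hC s hs t ht (by rwa [abs_of_nonneg (by linarith)])
    rwa [abs_of_nonneg (by linarith)] at this
  · refine key t ht s hs t ht hst h1 ?_
    have := hC t ht s hs (by rwa [abs_sub_comm, abs_of_nonneg (by linarith)])
    rwa [abs_sub_comm, abs_of_nonneg (by linarith), norm_sub_rev] at this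

lemma MemVarHolder.mono {E : Type*} [NormedAddCommGroup E] {T T' : ℝ} {α : ℝ → ℝ} {g : ℝ → E}
    (hg : MemVarHolder T α g) (h : T' ≤ T) : MemVarHolder T' α g := by
  obtain ⟨C, hC⟩ := hg
  exact ⟨C, fun t ht s hs hts => hC t ⟨ht.1, ht.2.trans h⟩ s hs ⟨hts.1, hts.2.trans h⟩⟩

lemma MemVarHolder.congr {E : Type*} [NormedAddCommGroup E] {T : ℝ} {α : ℝ → ℝ} {g g' : ℝ → E}
    (hg : MemVarHolder T α g) (h : ∀ t ∈ Set.Icc 0 T, g' t = g t) : MemVarHolder T α g' := by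
  obtain ⟨C, hC⟩ := hg
  exact ⟨C, fun t ht s hs hts => by rw [h _ ht, h _ hts]; exact hC t ht s hs hts⟩

/-! ### The delay equation, solved by steps -/

section Delay

variable {d n m : ℕ} {T : ℝ} {α : ℝ → ℝ} {τ : Fin (m + 1) → ℝ}
  {X : ℝ → EuclideanSpace ℝ (Fin d)}
  {f : (Fin (m + 1) → EuclideanSpace ℝ (Fin n)) →
    EuclideanSpace ℝ (Fin d) →L[ℝ] EuclideanSpace ℝ (Fin n)}
  {ξ Y Z : ℝ → EuclideanSpace ℝ (Fin n)}

lemma exists_almostAdditive_delay (hα : ∀ t ∈ Set.Icc 0 T, α t ∈ Set.Ioo (0 : ℝ) 1)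
    (hA1 : ConditionA1 T α) (hτ_pos : ∀ i, 0 < τ i) (hτ_mono : StrictMono τ)
    (hτα : ∃ β : ℝ, 1 < β ∧ ∀ i, ∀ t ∈ Set.Icc (τ i) T, β ≤ α t + α (t - τ i))
    (hX : MemVarHolder T α X) (hf : IsCb2 f)
    (hξ : ContDiffOn ℝ 1 ξ (Set.Icc (-τ (Fin.last m)) 0)) {T' T'' : ℝ} (hT' : 0 ≤ T')
    (hT''T : T'' ≤ T) (hT'' : ∀ i, T'' ≤ T' + τ i)
    (hYξ : ∀ u ∈ Set.Icc (-τ (Fin.last m)) 0, Y u = ξ u) (hY : MemVarHolder T' α Y) :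
    ∃ K θ, AlmostAdditive (youngGerm (fun r => f (fun i => Y (r - τ i))) X) 0 T'' K θ := by
  obtain ⟨C, hC1, hC⟩ := hA1.exists_rpow_le
  obtain ⟨a₀, ha₀, ha⟩ := hA1.exists_pos_le fun t ht => (hα t ht).1
  obtain ⟨β, hβ1, hβ⟩ := hτα
  obtain ⟨M, Lf, hM, hLf0, -, hLf⟩ := hf.exists_bound_lipschitz
  obtain ⟨L, hL0, hL⟩ := hξ.exists_norm_sub_le_Icc (by linarith [hτ_pos (Fin.last m)])
  obtain ⟨CX, hCX0, hCX⟩ := hX.exists_norm_sub_le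
  obtain ⟨CY, hCY0, hCY⟩ := hY.exists_norm_sub_le
  refine ⟨Lf * (CX * C * (CY + L)), min β (1 + a₀), fun u => by simp [youngGerm],
    lt_min hβ1 (by linarith), by positivity, fun u w v hu huw hwv hv h1 => ?_⟩
  set H := CX * C * (CY + L) * (v - u) ^ min β (1 + a₀) with hH
  have hinc : ∀ i, ‖Y (w - τ i) - Y (u - τ i)‖ * ‖X v - X w‖ ≤ H := by
    intro i
    have hi : -τ (Fin.last m) ≤ -τ i := neg_le_neg (hτ_mono.monotone (Fin.le_last i))
    refine norm_delay_increment_mul_le (hτ_pos i) hT'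
      (fun t ht => Set.Ioo_subset_Icc_self (hα t ht)) ha (hβ i) (min_le_left _ _)
      (min_le_right _ _) hC1 hC hCX0 hCX hCY0 hCY hL0 (fun x hx y hy => ?_) hu huw hwv
      (hv.trans hT''T) (hv.trans (hT'' i)) h1
    have hx' : x ∈ Set.Icc (-τ (Fin.last m)) 0 := ⟨hi.trans hx.1, hx.2⟩
    have hy' : y ∈ Set.Icc (-τ (Fin.last m)) 0 := ⟨hi.trans hy.1, hy.2⟩
    rw [hYξ x hx', hYξ y hy']
    exact hL x hx' y hy'
  -- The sup norm is handled componentwise after dividing by the increment of `X`, hence the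
  -- separate case where that increment is zero.
  have hsup : ‖(fun i => Y (w - τ i)) - fun i => Y (u - τ i)‖ * ‖X v - X w‖ ≤ H := by
    rcases (norm_nonneg (X v - X w)).eq_or_lt with h | h
    · have := hinc 0
      rw [← h, mul_zero] at this ⊢
      exact this
    · rw [← le_div_iff₀ h]
      refine (pi_norm_le_iff_of_nonneg ?_).2 fun i => ?_
      · exact (norm_nonneg _).trans ((le_div_iff₀ h).2 (hinc 0))
      · exact (le_div_iff₀ h).2 (hinc i)
  have key : youngGerm (fun r => f (fun i => Y (r - τ i))) X u v -
      youngGerm (fun r => f (fun i => Y (r - τ i))) X u w -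
      youngGerm (fun r => f (fun i => Y (r - τ i))) X w v =
      -((f (fun i => Y (w - τ i)) - f (fun i => Y (u - τ i))) (X v - X w)) := by
    simp only [youngGerm, sub_apply, map_sub]
    abel
  rw [key, norm_neg]
  refine (ContinuousLinearMap.le_opNorm _ _).trans ?_
  refine (mul_le_mul_of_nonneg_right (hLf _ _) (norm_nonneg _)).trans ?_
  rw [mul_assoc, mul_assoc Lf]
  exact mul_le_mul_of_nonneg_left hsup hLf0

lemma IsDelaySolution.eqOn (hτ_pos : ∀ i, 0 < τ i) (hτ_mono : StrictMono τ)
    (hY : IsDelaySolution T α τ f X ξ Y) (hZ : IsDelaySolution T α τ f X ξ Z) :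
    Set.EqOn Z Y (Set.Icc (-τ (Fin.last m)) T) := by
  have key : ∀ N : ℕ, ∀ t ∈ Set.Icc (-τ (Fin.last m)) T, t ≤ N * τ 0 → Z t = Y t := by
    intro N
    induction N with
    | zero =>
      intro t ht htN
      have ht' : t ∈ Set.Icc (-τ (Fin.last m)) 0 := ⟨ht.1, by simpa using htN⟩
      rw [hZ.initial t ht', hY.initial t ht']
    | succ N ih =>
      intro t ht htN
      rcases le_total t 0 with h0 | h0
      · rw [hZ.initial t ⟨ht.1, h0⟩, hY.initial t ⟨ht.1, h0⟩]
      · have h1 := hZ.equation t ⟨h0, ht.2⟩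
        refine sub_left_injective (b := ξ 0) ((h1.congr fun r hr => ?_).unique h0
          (hY.equation t ⟨h0, ht.2⟩))
        congr 1
        funext i
        have hi : τ i ≤ τ (Fin.last m) := hτ_mono.monotone (Fin.le_last i)
        have hi0 : τ 0 ≤ τ i := hτ_mono.monotone (Fin.zero_le i)
        push_cast at htN
        exact ih _ ⟨by linarith [hr.1], by linarith [hr.2, ht.2, hτ_pos i]⟩ (by linarith [hr.2])
  intro t ht
  obtain ⟨N, hN⟩ := exists_nat_ge (t / τ 0)
  exact key N t ht ((div_le_iff₀ (hτ_pos 0)).1 hN)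

/-- The integral of the old solution is taken afresh from `0` over the whole of `[0, T'']`. It
reproduces `Y` up to `T'` by uniqueness, and its Hölder bound comes in one piece, without gluing. -/
lemma IsDelaySolution.exists_extend (hα : ∀ t ∈ Set.Icc 0 T, α t ∈ Set.Ioo (0 : ℝ) 1)
    (hA1 : ConditionA1 T α) (hτ_pos : ∀ i, 0 < τ i) (hτ_mono : StrictMono τ)
    (hτα : ∃ β : ℝ, 1 < β ∧ ∀ i, ∀ t ∈ Set.Icc (τ i) T, β ≤ α t + α (t - τ i))
    (hX : MemVarHolder T α X) (hf : IsCb2 f)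
    (hξ : ContDiffOn ℝ 1 ξ (Set.Icc (-τ (Fin.last m)) 0)) {T' T'' : ℝ} (hT' : 0 ≤ T')
    (hT''T : T'' ≤ T) (hT'' : ∀ i, T'' ≤ T' + τ i)
    (hY : IsDelaySolution T' α τ f X ξ Y) : ∃ Z, IsDelaySolution T'' α τ f X ξ Z := by
  obtain ⟨K, θ, hA⟩ := exists_almostAdditive_delay hα hA1 hτ_pos hτ_mono hτα hX hf hξ hT'
    hT''T hT'' hY.initial hY.mem_varHolder
  obtain ⟨M, -, hM, -, hfM, -⟩ := hf.exists_bound_lipschitz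
  have hex : ∀ t, ∃ I, t ∈ Set.Icc 0 T'' →
      IsYoungIntegral (fun r => f (fun i => Y (r - τ i))) X 0 t I := by
    intro t
    by_cases ht : t ∈ Set.Icc 0 T''
    · obtain ⟨I, hI⟩ := (hA.mono ht.2).exists_isSewn ht.1
      exact ⟨I, fun _ => hI⟩
    · exact ⟨0, fun h => absurd h ht⟩
  choose I hI using hex
  have hIY : ∀ t ∈ Set.Icc 0 T'', t ≤ T' → ξ 0 + I t = Y t := fun t ht htT' => by
    rw [(hI t ht).unique ht.1 (hY.equation t ⟨ht.1, htT'⟩), add_sub_cancel]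
  have hY0 : Y 0 = ξ 0 := hY.initial 0 ⟨by linarith [hτ_pos (Fin.last m)], le_rfl⟩
  set Z : ℝ → EuclideanSpace ℝ (Fin n) := fun t => if t ≤ 0 then ξ t else ξ 0 + I t with hZdef
  have hZ0 : ∀ t ≤ 0, Z t = ξ t := fun t ht => if_pos ht
  have hZI : ∀ t ∈ Set.Icc 0 T'', Z t = ξ 0 + I t := by
    intro t ht
    rcases ht.1.eq_or_lt with h | h
    · rw [hIY t ht (h ▸ hT'), ← h, hZ0 0 le_rfl, hY0]
    · exact if_neg h.not_ge
  have hZY : ∀ t ∈ Set.Icc (-τ (Fin.last m)) T'', t ≤ T' → Z t = Y t := by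
    intro t ht htT'
    rcases le_total t 0 with h | h
    · rw [hZ0 t h, hY.initial t ⟨ht.1, h⟩]
    · rw [hZI t ⟨h, ht.2⟩, hIY t ⟨h, ht.2⟩ htT']
  refine ⟨Z, fun u hu => hZ0 u hu.2, ?_, fun t ht => ?_⟩
  · have h1 := (hX.mono hT''T).youngIntegral (fun t ht => (hα t ⟨ht.1, ht.2.trans hT''T⟩).2.le) hA
      hM (fun r => hfM _) fun t ht => hI t ht
    have h2 : MemVarHolder T'' α fun t => ξ 0 + I t := by
      simpa only [MemVarHolder, add_sub_add_left_eq_sub] using h1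
    exact h2.congr hZI
  · rw [hZI t ht, add_sub_cancel_left]
    refine (hI t ht).congr fun r hr => ?_
    congr 1
    funext i
    have hi : τ i ≤ τ (Fin.last m) := hτ_mono.monotone (Fin.le_last i)
    exact (hZY _ ⟨by linarith [hr.1], by linarith [hr.2, ht.2, hτ_pos i]⟩
      (by linarith [hr.2, ht.2, hT'' i])).symm

lemma isDelaySolution_zero (ξ : ℝ → EuclideanSpace ℝ (Fin n)) :
    IsDelaySolution 0 α τ f X ξ ξ := by
  refine ⟨fun _ _ => rfl, ⟨0, fun t ht h _ hth => ?_⟩, fun t ht ε hε => ⟨1, one_pos, ?_⟩⟩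
  · rw [le_antisymm hth.2 hth.1, le_antisymm ht.2 ht.1]
    simp
  · intro N p hp
    obtain rfl : t = 0 := le_antisymm ht.2 ht.1
    have hmono : ∀ j < N, p j ≤ p (j + 1) := fun j hj => (hp.2.2 j hj).1
    have h0 : ∀ j ≤ N, p j = 0 := fun j hj =>
      le_antisymm (hp.2.1 ▸ le_of_le_succ_of_lt hmono hj le_rfl)
        (hp.1 ▸ le_of_le_succ_of_lt hmono (Nat.zero_le j) hj)
    rw [Finset.sum_eq_zero fun j hj => ?_]
    · simpa using hε
    · rw [h0 j (Finset.mem_range.1 hj).le, h0 (j + 1) (Finset.mem_range.1 hj), sub_self, map_zero]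

end Delay

theorem mainTheorem1 (d n m : ℕ) (T : ℝ) (hT : 0 < T) (α : ℝ → ℝ)
    (hα : ∀ t ∈ Set.Icc 0 T, α t ∈ Set.Ioo (0 : ℝ) 1) (hA1 : ConditionA1 T α)
    (τ : Fin (m + 1) → ℝ) (hτ_pos : ∀ i, 0 < τ i) (hτ_mono : StrictMono τ)
    (hτα : ∃ β : ℝ, 1 < β ∧ ∀ i, ∀ t ∈ Set.Icc (τ i) T, β ≤ α t + α (t - τ i))
    (X : ℝ → EuclideanSpace ℝ (Fin d)) (hX : MemVarHolder T α X)
    (f : (Fin (m + 1) → EuclideanSpace ℝ (Fin n)) →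
      EuclideanSpace ℝ (Fin d) →L[ℝ] EuclideanSpace ℝ (Fin n))
    (hf : IsCb2 f)
    (ξ : ℝ → EuclideanSpace ℝ (Fin n))
    (hξ : ContDiffOn ℝ 1 ξ (Set.Icc (-τ (Fin.last m)) 0)) :
    ∃ Y : ℝ → EuclideanSpace ℝ (Fin n), IsDelaySolution T α τ f X ξ Y ∧
      ∀ Z : ℝ → EuclideanSpace ℝ (Fin n), IsDelaySolution T α τ f X ξ Z →
        Set.EqOn Z Y (Set.Icc (-τ (Fin.last m)) T) := by
  have h0 := hτ_pos 0
  -- Each step advances by the shortest delay `τ 0`, until `T` is reached.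
  have key : ∀ N : ℕ, ∃ Y, IsDelaySolution (min (N * τ 0) T) α τ f X ξ Y := by
    intro N
    induction N with
    | zero => exact ⟨ξ, by simpa [hT.le] using isDelaySolution_zero ξ⟩
    | succ N ih =>
      obtain ⟨Y, hY⟩ := ih
      refine hY.exists_extend hα hA1 hτ_pos hτ_mono hτα hX hf hξ (le_min (by positivity) hT.le)
        (min_le_right _ _) fun i => ?_
      have hi : τ 0 ≤ τ i := hτ_mono.monotone (Fin.zero_le i)
      rw [← min_add_add_right]
      refine min_le_min ?_ (by linarith)
      push_cast
      linarith
  obtain ⟨N, hN⟩ := exists_nat_ge (T / τ 0)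
  obtain ⟨Y, hY⟩ := key N
  rw [min_eq_right ((div_le_iff₀ h0).1 hN)] at hY
  exact ⟨Y, hY, fun Z hZ => hY.eqOn hτ_pos hτ_mono hZ⟩
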